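/- Let $n,\ell\ge 0$ be integers, let $\mathrm{Sym}(n)$ be the space of real symmetric $n\times n$ matrices, of dimension $m=n(n+1)/2$, and let $\mathrm{SPD}(n)\subset\mathrm{Sym}(n)$ be the open set of positive definite matrices. For $P,Q\in\mathrm{SPD}(n)$ and $W\in\mathrm{Sym}(n)$ let $$d(P,Q)=\mathrm{Tr}\big(\log(P^{-1/2}QP^{-1/2})^2\big)^{1/2},\quad \exp_P(W)=P^{1/2}\exp(P^{-1/2}WP^{-1/2})P^{1/2},\quad \log_P(Q)=P^{1/2}\log(P^{-1/2}QP^{-1/2})P^{1/2}$$ be the Riemannian distance, exponential map and logarithm map of the affine-invariant metric $\langle V,W\rangle_P=\mathrm{Tr}(P^{-1}VP^{-1}W)$. For $P\in\mathrm{SPD}(n)$ and $0\neq V\in\mathrm{Sym}(n)$, the geodesic hyperplane with base point $P$ and normal $V$ is $\mathcal H_{P,V^\perp}=\{\exp_P(W): W\in\mathrm{Sym}(n),\ \mathrm{Tr}(VW)=0\}$. Let $R_1,\dots,R_\ell\in\mathrm{SPD}(n)$, let $F(P)=(d(R_1,P)^2,\dots,d(R_\ell,P)^2)\in\mathbb R^\ell$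 be the squared Fréchet map, and let $$\Gamma_{R_1,\dots,R_\ell}=\{P\in\mathrm{SPD}(n):\ \operatorname{rank}(\log_P R_1,\dots,\log_P R_\ell)=m\}.$$ Call $F$ locally invertible at $P$ if $DF(P)$ exists and has rank $m$, and $F$ restricts to a diffeomorphism ($C^\infty$) from an open neighbourhood $U\subseteq \mathrm{SPD}(n)$ of $P$ onto its image $F(U)\subset\mathbb R^\ell$ (the inverse $F(U)\to U$ being the restriction of a $C^\infty$ map on an open subset of $\mathbb R^\ell$ containing $F(U)$). Then: 1. $F$ is locally invertible at every point of $\Gamma_{R_1,\dots,R_\ell}$. 2. $\Gamma_{R_1,\dots,R_\ell}$ is the complement in $\mathrm{SPD}(n)$ of the set of those $P$ that are the base point of a geodesic hyperplane $\mathcal H_{P,V^\perp}$, $V\ne0$, containing $R_1,\dots,R_\ell$. 3. In particular $$\mathrm{SPD}(n)\setminus\bigcup\{\mathcal H_{P,V^\perp}:\ P\in\mathrm{SPD}(n),\ V\neq 0,\ R_1,\dots,R_\ell\in\mathcal H_{P,V^\perp}\}\subseteq\Gamma_{R_1,\dots,R_\ell},$$ and $F$ is locally invertible at every point of the left-hand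 side. -/

import Mathlib

open scoped ContDiff

noncomputable section

namespace SPDGeometry

/-- The real vector space `Sym(n)` of symmetric `n × n` matrices. -/
def Sym (n : ℕ) : Submodule ℝ (Matrix (Fin n) (Fin n) ℝ) where
  carrier := {A | A.IsSymm}
  add_mem' hA hB := Matrix.IsSymm.add hA hB
  zero_mem' := Matrix.isSymm_zero
  smul_mem' c _ hA := Matrix.IsSymm.smul hA c

/-- The manifold `SPD(n)` of symmetric positive definite matrices, an open subset of `Sym(n)`. -/
def SPD (n : ℕ) : Set (Sym n) := {P | (P : Matrix (Fin n) (Fin n) ℝ).PosDef}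

/-- The square root `P^{1/2}` (functional calculus of symmetric matrices). -/
def matSqrt {n : ℕ} (P : Matrix (Fin n) (Fin n) ℝ) : Matrix (Fin n) (Fin n) ℝ :=
  cfc Real.sqrt P

/-- The matrix logarithm (functional calculus of symmetric matrices). -/
def matLog {n : ℕ} (P : Matrix (Fin n) (Fin n) ℝ) : Matrix (Fin n) (Fin n) ℝ :=
  cfc Real.log P

/-- The conjugation `A ↦ P^{-1/2} A P^{-1/2}`. -/
def whiten {n : ℕ} (P A : Matrix (Fin n) (Fin n) ℝ) : Matrix (Fin n) (Fin n) ℝ :=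
  (matSqrt P)⁻¹ * A * (matSqrt P)⁻¹

/-- The Riemannian exponential map of the affine-invariant metric,
`exp_P(W) = P^{1/2} exp(P^{-1/2} W P^{-1/2}) P^{1/2}`. -/
def expMap {n : ℕ} (P W : Sym n) : Matrix (Fin n) (Fin n) ℝ :=
  matSqrt P * NormedSpace.exp (whiten (P : Matrix (Fin n) (Fin n) ℝ) W) * matSqrt P

/-- The Riemannian logarithm map of the affine-invariant metric,
`log_P(Q) = P^{1/2} log(P^{-1/2} Q P^{-1/2}) P^{1/2}`. -/
def logMap {n : ℕ} (P Q : Sym n) : Matrix (Fin n) (Fin n) ℝ :=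
  matSqrt P * matLog (whiten (P : Matrix (Fin n) (Fin n) ℝ) Q) * matSqrt P

/-- The Riemannian distance of the affine-invariant metric,
`d(P, Q) = Tr(log(P^{-1/2} Q P^{-1/2})^2)^{1/2}`. -/
def riemDist {n : ℕ} (P Q : Sym n) : ℝ :=
  Real.sqrt (Matrix.trace (matLog (whiten (P : Matrix (Fin n) (Fin n) ℝ) Q) ^ 2))

/-- The squared Fréchet map `F(P) = (d(R_1, P)^2, …, d(R_ℓ, P)^2)`. It is meaningful on the open
subset `SPD(n)` of `Sym(n)`; only its values there matter below. -/
def frechetMap {n ℓ : ℕ} (R : Fin ℓ → SPD n) (P : Sym n) : Fin ℓ → ℝ :=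
  fun i => riemDist (R i) P ^ 2

/-- `Γ_{R_1,…,R_ℓ}`: the `P ∈ SPD(n)` for which `(log_P R_1, …, log_P R_ℓ)` has rank
`m = n(n+1)/2`. -/
def Gam {n ℓ : ℕ} (R : Fin ℓ → SPD n) : Set (Sym n) :=
  {P | P ∈ SPD n ∧
    Module.finrank ℝ (Submodule.span ℝ (Set.range fun i => logMap P (R i)))
      = n * (n + 1) / 2}

/-- The Riemannian geodesic hyperplane
`H_{P,V^⊥} = {exp_P(W) : W ∈ Sym(n), Tr(VW) = 0}`. -/
def geodHyperplane {n : ℕ} (P V : Sym n) : Set (Sym n) :=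
  {Q | ∃ W : Sym n, Matrix.trace ((V : Matrix (Fin n) (Fin n) ℝ) * (W : Matrix (Fin n) (Fin n) ℝ)) = 0 ∧
    (Q : Matrix (Fin n) (Fin n) ℝ) = expMap P W}

/-- The geodesic hyperplanes `H_{P,V^⊥}`, with `P ∈ SPD(n)` and `V ∈ Sym(n)` non-zero, that contain
all the reference points. -/
def hyperplanesThrough {n ℓ : ℕ} (R : Fin ℓ → SPD n) : Set (Set (Sym n)) :=
  {H | (∃ P ∈ SPD n, ∃ V : Sym n, V ≠ 0 ∧ H = geodHyperplane P V) ∧ ∀ i, (R i : Sym n) ∈ H}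

section Differential

-- `Sym(n)` with the Frobenius norm
attribute [local instance] Matrix.frobeniusNormedAddCommGroup Matrix.frobeniusNormedSpace

/-- The differential of `F` at `P` exists and has rank `m = n(n+1)/2`. -/
def HasFullRankDifferentialAt {n ℓ : ℕ} (F : Sym n → Fin ℓ → ℝ) (P : Sym n) : Prop :=
  DifferentiableAt ℝ F P ∧
    Module.finrank ℝ (LinearMap.range (fderiv ℝ F P).toLinearMap) = n * (n + 1) / 2

/-- `F` restricts to a diffeomorphism from an open neighbourhood `U ⊆ SPD(n)` of `P` onto its
image `F(U)`: it is smooth on `U`, and its inverse `F(U) → U` is the restriction of a smooth map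
defined on an open subset of `ℝ^ℓ` that contains `F(U)`. -/
def IsLocalDiffeoOntoImageAt {n ℓ : ℕ} (F : Sym n → Fin ℓ → ℝ) (P : Sym n) : Prop :=
  ∃ U : Set (Sym n), IsOpen U ∧ P ∈ U ∧ U ⊆ SPD n ∧ ContDiffOn ℝ ∞ F U ∧
    ∃ (W : Set (Fin ℓ → ℝ)) (G : (Fin ℓ → ℝ) → Sym n),
      IsOpen W ∧ F '' U ⊆ W ∧ ContDiffOn ℝ ∞ G W ∧ ∀ Q ∈ U, G (F Q) = Q

/-- Local invertibility at `P`: the differential has full rank, and `F` is a diffeomorphism from a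
neighbourhood of `P` onto the image of that neighbourhood. -/
def IsLocallyInvertibleAt {n ℓ : ℕ} (F : Sym n → Fin ℓ → ℝ) (P : Sym n) : Prop :=
  HasFullRankDifferentialAt F P ∧ IsLocalDiffeoOntoImageAt F P

end Differential

end SPDGeometry

end

/-!
The function `P ↦ d(R, P)²` is `Tr (log A)²` with `A = R^{-1/2} P R^{-1/2}`, and everything rests on
its being analytic with differential `H ↦ -2 Tr (P⁻¹ H P⁻¹ log_P R)`.

*Analyticity.* The exponential is analytic, so by the inverse function theorem it is enough that its
differential at every `X ∈ Sym(n)` is injective on `Sym(n)`. Differentiating `e^X X = X e^X` shows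
that a direction `H` killed by the differential commutes with `e^X`, hence with `X = log e^X`; on
commuting directions the differential is `H ↦ e^X H`, so `H = 0` (`fderiv_expSym_injective`). The
inverse function theorem also shows that `SPD(n) = exp (Sym(n))` is open.

*Differential.* From `e^X = (e^{X/N})^N` with `N → ∞` one gets `Tr (Z Dexp_X K) = Tr (Z e^X K)` for
every `Z` that commutes with `X` (`trace_mul_fderiv_exp`). Hence `Tr (log A)²` has at `A` the
differential `H ↦ 2 Tr (log A · A⁻¹ H)`. Base point and argument are exchanged by the fact that
`R^{-1/2} P R^{-1/2}` and `(P^{-1/2} R P^{-1/2})⁻¹` are intertwined by `P^{1/2} R^{-1/2}`, and so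
are their logarithms (`matLog_whiten_swap`, `fderiv_riemDist_sq`).

*Conclusion.* As `exp_P` is inverse to `log_P`, the points `R_i` lie on the hyperplane with
base point `P` and normal `V` exactly if `Tr (V log_P R_i) = 0` for all `i`. By nondegeneracy of the
trace form, such a `V ≠ 0` exists exactly if the `log_P R_i` fail to span `Sym(n)` (`mem_Gam_iff`).
If they do span, then the differential of `F` is injective, because `H` in its kernel makes
`V = P⁻¹ H P⁻¹` orthogonal to all of them, and an analytic immersion has a smooth left inverse near
the image point (`exists_contDiffOn_leftInverse`). The third assertion follows since `P` itself lies
on every geodesic hyperplane with base point `P`.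
-/

/-! ### The differential of the exponential in a Banach algebra -/

section BanachAlgebra

variable {𝔸 : Type*} [NormedRing 𝔸] [NormedAlgebra ℝ 𝔸] [CompleteSpace 𝔸]

open NormedSpace

theorem contDiff_normedSpace_exp {m : WithTop ℕ∞} : ContDiff ℝ m (exp : 𝔸 → 𝔸) :=
  contDiff_iff_contDiffAt.2 fun x => (exp_analytic (𝕂 := ℝ) x).contDiffAt

theorem hasFDerivAt_normedSpace_exp (x : 𝔸) :
    HasFDerivAt (exp : 𝔸 → 𝔸) (fderiv ℝ exp x) x :=
  (exp_analytic (𝕂 := ℝ) x).differentiableAt.hasFDerivAt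

/-- The curve `t ↦ exp (x + t k) = exp x * exp (t k)` has velocity `exp x * k` at `0`. -/
theorem fderiv_exp_apply_of_commute {x k : 𝔸} (h : Commute x k) :
    fderiv ℝ exp x k = exp x * k := by
  let _ : NormedAlgebra ℚ 𝔸 := .restrictScalars ℚ ℝ 𝔸
  have h1 : HasDerivAt (fun t : ℝ => exp (x + t • k)) (fderiv ℝ exp x k) 0 := by
    have hc : HasDerivAt (fun t : ℝ => x + t • k) k 0 := by
      simpa using ((hasDerivAt_id (0 : ℝ)).smul_const k).const_add x
    have := (hasFDerivAt_normedSpace_exp (x + (0 : ℝ) • k)).comp_hasDerivAt (0 : ℝ) hc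
    simpa [Function.comp_def] using this
  have h2 : HasDerivAt (fun t : ℝ => exp (x + t • k)) (exp x * k) 0 := by
    have he := (hasDerivAt_exp_smul_const (𝕂 := ℝ) k (0 : ℝ)).const_mul (exp x)
    simp only [zero_smul, exp_zero, one_mul] at he
    refine he.congr_of_eventuallyEq (.of_forall fun t => ?_)
    exact exp_add_of_commute (h.smul_right t)
  exact h1.unique h2

/-- Differentiating `exp y * y = y * exp y` at `x` in a direction killed by the derivative of `exp`
shows that this direction commutes with `exp x`. -/
theorem commute_exp_of_fderiv_exp_eq_zero {x k : 𝔸} (h : fderiv ℝ exp x k = 0) :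
    Commute (exp x) k := by
  have hE := hasFDerivAt_normedSpace_exp x
  have h1 := hE.mul' (hasFDerivAt_id x)
  have h2 := (hasFDerivAt_id x).mul' hE
  have heq : (exp * id : 𝔸 → 𝔸) = id * exp := funext fun y => (Commute.refl y).exp_left
  rw [heq] at h1
  simpa [h, Commute, SemiconjBy] using DFunLike.congr_fun (h1.unique h2) k

/-- For a tracial functional `τ`, the derivative of `exp` at `x` agrees with `k ↦ exp x * k` when
tested against elements commuting with `x`. -/
theorem trace_mul_fderiv_exp (τ : 𝔸 →L[ℝ] ℝ) (hτ : ∀ a b, τ (a * b) = τ (b * a))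
    {x z : 𝔸} (hz : Commute z x) (k : 𝔸) :
    τ (z * fderiv ℝ exp x k) = τ (z * exp x * k) := by
  let _ : NormedAlgebra ℚ 𝔸 := .restrictScalars ℚ ℝ 𝔸
  -- As `exp y = exp (y / N) ^ N`, the point `x` may be replaced by `x / N`; the factor
  -- `exp x * exp (-x / N)` is `exp (x / N) ^ (N - 1)` in a form whose limit is visible.
  have key : ∀ N : ℕ, 0 < N → τ (z * fderiv ℝ exp x k) =
      τ (z * exp x * exp (-((N : ℝ)⁻¹ • x)) * fderiv ℝ exp ((N : ℝ)⁻¹ • x) k) := by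
    intro N hN
    have hN' : (N : ℝ) ≠ 0 := by positivity
    set u : 𝔸 := (N : ℝ)⁻¹ • x with hu
    have hzu : Commute z (exp u) := (hz.smul_right _).exp_right
    have hpow : ∀ y : 𝔸, exp ((N : ℝ)⁻¹ • y) ^ N = exp y := fun y => by
      rw [← exp_nsmul, ← Nat.cast_smul_eq_nsmul ℝ, smul_inv_smul₀ hN']
    have hd : HasFDerivAt (fun y : 𝔸 => exp ((N : ℝ)⁻¹ • y))
        ((fderiv ℝ exp u).comp ((N : ℝ)⁻¹ • ContinuousLinearMap.id ℝ 𝔸)) x :=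
      HasFDerivAt.comp x (hasFDerivAt_normedSpace_exp u)
        ((hasFDerivAt_id x).const_smul (N : ℝ)⁻¹)
    have hd2 := (hd.pow' N).congr_of_eventuallyEq (.of_forall fun y => (hpow y).symm)
    rw [hd2.fderiv]
    have hsum : ∀ i ∈ Finset.range N,
        τ (z * (exp u ^ (N.pred - i) * ((N : ℝ)⁻¹ • fderiv ℝ exp u k) * exp u ^ i))
          = (N : ℝ)⁻¹ * τ (z * exp u ^ (N - 1) * fderiv ℝ exp u k) := by
      intro i hi
      have hi' := Finset.mem_range.1 hi
      rw [mul_assoc (exp u ^ _), ← mul_assoc z, hτ, mul_assoc, ← mul_assoc _ z,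
        ← (hzu.pow_right i).eq, mul_assoc z, ← pow_add, smul_mul_assoc, map_smul, hτ]
      simp only [smul_eq_mul]
      congr 5
      simp; omega
    have hE : z * exp x * exp (-u) = z * exp u ^ (N - 1) := by
      rw [← hpow x, ← hu, mul_assoc]
      congr 1
      obtain ⟨m, rfl⟩ : ∃ m, N = m + 1 := ⟨N - 1, by omega⟩
      rw [pow_succ, mul_assoc, ← exp_add_of_commute (Commute.refl u).neg_right]
      simp
    rw [hE]
    have hcalc : τ (z * (∑ i ∈ Finset.range N,
        exp u ^ (N.pred - i) * ((N : ℝ)⁻¹ • fderiv ℝ exp u k) * exp u ^ i)) =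
        τ (z * exp u ^ (N - 1) * fderiv ℝ exp u k) := by
      rw [Finset.mul_sum, map_sum, Finset.sum_congr rfl hsum]
      simp [hN']
    rw [← hcalc]
    simp [hu]
  -- In the limit `N → ∞` the derivative at `x / N` becomes the identity.
  have hlim : Filter.Tendsto (fun N : ℕ => (N : ℝ)⁻¹ • x) Filter.atTop (nhds 0) := by
    simpa using (tendsto_inv_atTop_nhds_zero_nat (𝕜 := ℝ)).smul_const x
  have hcont : Continuous fun u : 𝔸 => τ (z * exp x * exp (-u) * fderiv ℝ exp u k) := by
    have h1 : Continuous (fderiv ℝ (exp : 𝔸 → 𝔸)) :=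
      contDiff_normedSpace_exp.continuous_fderiv (n := 1) one_ne_zero
    have h2 : Continuous (exp : 𝔸 → 𝔸) := contDiff_normedSpace_exp (m := 0).continuous
    fun_prop
  have ht := (hcont.tendsto 0).comp hlim
  have h0 : fderiv ℝ exp (0 : 𝔸) k = k := by
    simp [fderiv_exp_apply_of_commute (Commute.zero_left k)]
  simp only [neg_zero, exp_zero, mul_one, h0] at ht
  refine tendsto_nhds_unique (tendsto_const_nhds.congr' ?_) ht
  filter_upwards [Filter.eventually_gt_atTop 0] with N hN using key N hN

end BanachAlgebra

namespace SPDGeometry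

open Matrix

variable {n : ℕ}

/-! ### Square root, exponential and logarithm of symmetric matrices -/

section FunctionalCalculus

/-- An intertwining relation between two symmetric matrices passes to their functional calculi,
because on the finite union of the two spectra every function is a polynomial. -/
theorem mul_cfc_eq_cfc_mul {A B X : Matrix (Fin n) (Fin n) ℝ} (f : ℝ → ℝ)
    (hA : IsSelfAdjoint A) (hB : IsSelfAdjoint B) (h : X * A = B * X) :
    X * cfc f A = cfc f B * X := by
  classical
  have hfin : (spectrum ℝ A ∪ spectrum ℝ B).Finite :=
    (Matrix.finite_real_spectrum).union Matrix.finite_real_spectrum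
  let q : Polynomial ℝ := Lagrange.interpolate hfin.toFinset id f
  have hq : ∀ x ∈ spectrum ℝ A ∪ spectrum ℝ B, f x = q.eval x := fun x hx =>
    (Lagrange.eval_interpolate_at_node f (Set.injOn_id _) (hfin.mem_toFinset.2 hx)).symm
  have hsemi : SemiconjBy X A B := h
  have hpoly : ∀ r : Polynomial ℝ,
      X * Polynomial.aeval A r = Polynomial.aeval B r * X := by
    intro r
    induction r using Polynomial.induction_on' with
    | add r s hr hs => simp [mul_add, add_mul, hr, hs]
    | monomial k c =>
      simp only [Polynomial.aeval_monomial, ← Algebra.smul_def, mul_smul_comm, smul_mul_assoc,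
        (hsemi.pow_right k).eq]
  rw [cfc_congr (a := A) fun x hx => hq x (.inl hx), cfc_congr (a := B) fun x hx => hq x (.inr hx),
    cfc_polynomial q A hA, cfc_polynomial q B hB]
  exact hpoly q

theorem isSelfAdjoint_of_isSymm {A : Matrix (Fin n) (Fin n) ℝ} (hA : A.IsSymm) :
    IsSelfAdjoint A := by
  rw [IsSelfAdjoint, star_eq_conjTranspose, conjTranspose_eq_transpose_of_trivial]
  exact hA

theorem isSymm_of_isSelfAdjoint {A : Matrix (Fin n) (Fin n) ℝ} (hA : IsSelfAdjoint A) :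
    A.IsSymm := by
  rw [IsSelfAdjoint, star_eq_conjTranspose, conjTranspose_eq_transpose_of_trivial] at hA
  exact hA

theorem isSymm_of_posDef {A : Matrix (Fin n) (Fin n) ℝ} (hA : A.PosDef) : A.IsSymm :=
  isSymm_of_isSelfAdjoint hA.1

theorem matLog_isSymm (A : Matrix (Fin n) (Fin n) ℝ) : (matLog A).IsSymm :=
  isSymm_of_isSelfAdjoint (cfc_predicate Real.log A)

theorem matSqrt_isSymm (A : Matrix (Fin n) (Fin n) ℝ) : (matSqrt A).IsSymm :=
  isSymm_of_isSelfAdjoint (cfc_predicate Real.sqrt A)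

theorem inv_isSymm {A : Matrix (Fin n) (Fin n) ℝ} (hA : A.IsSymm) : A⁻¹.IsSymm := by
  rw [IsSymm, transpose_nonsing_inv, hA.eq]

theorem mul_mul_isSymm {A S : Matrix (Fin n) (Fin n) ℝ} (hS : S.IsSymm) (hA : A.IsSymm) :
    (S * A * S).IsSymm := by
  rw [IsSymm, transpose_mul, transpose_mul, hS.eq, hA.eq, mul_assoc]

theorem mul_mul_posDef {A S : Matrix (Fin n) (Fin n) ℝ} (hS : S.IsSymm) (hu : IsUnit S)
    (hA : A.PosDef) : (S * A * S).PosDef := by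
  have h := hA.conjTranspose_mul_mul_same (B := S) (mulVec_injective_of_isUnit hu)
  rwa [conjTranspose_eq_transpose_of_trivial, hS.eq] at h

section

open scoped Matrix.Norms.L2Operator MatrixOrder

theorem exp_matLog {A : Matrix (Fin n) (Fin n) ℝ} (hA : A.PosDef) :
    NormedSpace.exp (matLog A) = A :=
  CFC.exp_log A hA.isStrictlyPositive

theorem matLog_exp {A : Matrix (Fin n) (Fin n) ℝ} (hA : A.IsSymm) :
    matLog (NormedSpace.exp A) = A :=
  CFC.log_exp A (isSelfAdjoint_of_isSymm hA)

theorem posDef_exp {A : Matrix (Fin n) (Fin n) ℝ} (hA : A.IsSymm) :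
    (NormedSpace.exp A).PosDef := by
  let _ : NormedAlgebra ℚ (Matrix (Fin n) (Fin n) ℝ) := .restrictScalars ℚ ℝ _
  rw [← Matrix.isStrictlyPositive_iff_posDef]
  exact IsStrictlyPositive.iff_of_unital.2
    ⟨(isSelfAdjoint_of_isSymm hA).exp_nonneg, NormedSpace.isUnit_exp A⟩

theorem matSqrt_mul_self {A : Matrix (Fin n) (Fin n) ℝ} (hA : A.PosDef) :
    matSqrt A * matSqrt A = A := by
  have hA' : (0 : Matrix (Fin n) (Fin n) ℝ) ≤ A := hA.isStrictlyPositive.nonneg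
  rw [matSqrt, ← cfc_mul Real.sqrt Real.sqrt A]
  conv_rhs => rw [← cfc_id ℝ A hA.1]
  exact cfc_congr fun x hx => Real.mul_self_sqrt (spectrum_nonneg_of_nonneg hA' hx)

end

theorem isUnit_matSqrt {A : Matrix (Fin n) (Fin n) ℝ} (hA : A.PosDef) : IsUnit (matSqrt A) := by
  have h := hA.isUnit
  rw [← matSqrt_mul_self hA] at h
  exact isUnit_of_mul_isUnit_left h

theorem matLog_inv {A : Matrix (Fin n) (Fin n) ℝ} (hA : A.PosDef) : matLog A⁻¹ = -matLog A := by
  rw [← matLog_exp (matLog_isSymm A).neg, Matrix.exp_neg, exp_matLog hA]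

end FunctionalCalculus

/-! ### The congruence `A ↦ P^{-1/2} A P^{-1/2}` -/

section Whitening

theorem isUnit_inv_matSqrt {P : Matrix (Fin n) (Fin n) ℝ} (hP : P.PosDef) :
    IsUnit (matSqrt P)⁻¹ :=
  (isUnit_nonsing_inv_iff).2 (isUnit_matSqrt hP)

theorem inv_matSqrt_mul {P : Matrix (Fin n) (Fin n) ℝ} (hP : P.PosDef) :
    (matSqrt P)⁻¹ * matSqrt P = 1 :=
  nonsing_inv_mul _ ((isUnit_iff_isUnit_det _).1 (isUnit_matSqrt hP))

theorem matSqrt_mul_inv {P : Matrix (Fin n) (Fin n) ℝ} (hP : P.PosDef) :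
    matSqrt P * (matSqrt P)⁻¹ = 1 :=
  mul_nonsing_inv _ ((isUnit_iff_isUnit_det _).1 (isUnit_matSqrt hP))

theorem whiten_isSymm (P : Matrix (Fin n) (Fin n) ℝ) {A : Matrix (Fin n) (Fin n) ℝ}
    (hA : A.IsSymm) : (whiten P A).IsSymm :=
  mul_mul_isSymm (inv_isSymm (matSqrt_isSymm P)) hA

theorem whiten_posDef {P A : Matrix (Fin n) (Fin n) ℝ} (hP : P.PosDef) (hA : A.PosDef) :
    (whiten P A).PosDef :=
  mul_mul_posDef (inv_isSymm (matSqrt_isSymm P)) (isUnit_inv_matSqrt hP) hA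

theorem whiten_matSqrt_mul_mul {P : Matrix (Fin n) (Fin n) ℝ} (hP : P.PosDef)
    (A : Matrix (Fin n) (Fin n) ℝ) : whiten P (matSqrt P * A * matSqrt P) = A := by
  have h1 := inv_matSqrt_mul hP
  have h2 := matSqrt_mul_inv hP
  simp only [whiten, mul_assoc, h2, mul_one]
  rw [← mul_assoc, h1, one_mul]

theorem matSqrt_mul_whiten_mul {P : Matrix (Fin n) (Fin n) ℝ} (hP : P.PosDef)
    (A : Matrix (Fin n) (Fin n) ℝ) : matSqrt P * whiten P A * matSqrt P = A := by
  have h1 := inv_matSqrt_mul hP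
  have h2 := matSqrt_mul_inv hP
  simp only [whiten, mul_assoc, h1, mul_one]
  rw [← mul_assoc, h2, one_mul]

theorem inv_matSqrt_mul_self {P : Matrix (Fin n) (Fin n) ℝ} (hP : P.PosDef) :
    (matSqrt P)⁻¹ * (matSqrt P)⁻¹ = P⁻¹ := by
  rw [← Matrix.mul_inv_rev, matSqrt_mul_self hP]

/-- Exchanging base point and argument: up to the congruences by the two square roots, the
logarithm changes its sign. The matrices `R^{-1/2} P R^{-1/2}` and `(P^{-1/2} R P^{-1/2})⁻¹` are
intertwined by `P^{1/2} R^{-1/2}`, hence so are their logarithms. -/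
theorem matLog_whiten_swap {P R : Matrix (Fin n) (Fin n) ℝ} (hP : P.PosDef) (hR : R.PosDef) :
    (matSqrt R)⁻¹ * (matLog (whiten R P) * (whiten R P)⁻¹) * (matSqrt R)⁻¹ =
      -((matSqrt P)⁻¹ * matLog (whiten P R) * (matSqrt P)⁻¹) := by
  have hA := whiten_posDef hR hP
  have hB := whiten_posDef hP hR
  have hp1 := inv_matSqrt_mul hP
  have hp2 := matSqrt_mul_inv hP
  have hr1 := inv_matSqrt_mul hR
  have hr2 := matSqrt_mul_inv hR
  have hpp := matSqrt_mul_self hP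
  have hTT := inv_matSqrt_mul_self hP
  have hSS := inv_matSqrt_mul_self hR
  have hAinv : (whiten R P)⁻¹ = matSqrt R * P⁻¹ * matSqrt R := by
    rw [whiten, Matrix.mul_inv_rev, Matrix.mul_inv_rev, nonsing_inv_nonsing_inv _
      ((isUnit_iff_isUnit_det _).1 (isUnit_matSqrt hR)), mul_assoc]
  have hBinv : (whiten P R)⁻¹ = matSqrt P * R⁻¹ * matSqrt P := by
    rw [whiten, Matrix.mul_inv_rev, Matrix.mul_inv_rev, nonsing_inv_nonsing_inv _
      ((isUnit_iff_isUnit_det _).1 (isUnit_matSqrt hP)), mul_assoc]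
  have hint : (matSqrt P * (matSqrt R)⁻¹) * whiten R P =
      (whiten P R)⁻¹ * (matSqrt P * (matSqrt R)⁻¹) := by
    calc (matSqrt P * (matSqrt R)⁻¹) * whiten R P
        = matSqrt P * (matSqrt R)⁻¹ *
            ((matSqrt R)⁻¹ * (matSqrt P * matSqrt P) * (matSqrt R)⁻¹) := by
          rw [hpp, whiten]
      _ = _ := by rw [hBinv, ← hSS]; simp only [mul_assoc]
  have hlog := mul_cfc_eq_cfc_mul Real.log hA.1 hB.inv.1 hint
  change _ * matLog _ = matLog _ * _ at hlog
  rw [matLog_inv hB] at hlog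
  rw [hAinv, ← hTT]
  generalize matSqrt P = p at *
  generalize matSqrt R = r at *
  generalize matLog (whiten R P) = a at *
  generalize matLog (whiten P R) = b at *
  calc r⁻¹ * (a * (r * (p⁻¹ * p⁻¹) * r)) * r⁻¹
      = r⁻¹ * a * r * p⁻¹ * p⁻¹ * (r * r⁻¹) := by simp only [mul_assoc]
    _ = (p⁻¹ * p) * (r⁻¹ * a * r * p⁻¹ * p⁻¹) := by rw [hr2, hp1, mul_one, one_mul]
    _ = p⁻¹ * (p * r⁻¹ * a) * r * p⁻¹ * p⁻¹ := by simp only [mul_assoc]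
    _ = -(p⁻¹ * b * p * (r⁻¹ * r) * p⁻¹ * p⁻¹) := by
      rw [hlog]; simp only [mul_assoc, neg_mul, mul_neg]
    _ = -(p⁻¹ * b * (p * p⁻¹) * p⁻¹) := by rw [hr1]; simp only [mul_assoc, one_mul]
    _ = -(p⁻¹ * b * p⁻¹) := by rw [hp2, mul_one]

/-- The left-hand side is half the differential of `d(R, ·)²` at `P` in direction `H`; on the right
it is expressed through `log_P(R)`. -/
theorem trace_matLog_whiten {P R : Matrix (Fin n) (Fin n) ℝ} (hP : P.PosDef) (hR : R.PosDef)
    (H : Matrix (Fin n) (Fin n) ℝ) :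
    trace (matLog (whiten R P) * (whiten R P)⁻¹ * whiten R H) =
      -trace (P⁻¹ * H * P⁻¹ * (matSqrt P * matLog (whiten P R) * matSqrt P)) := by
  have hp1 := inv_matSqrt_mul hP
  have hp2 := matSqrt_mul_inv hP
  calc trace (matLog (whiten R P) * (whiten R P)⁻¹ * whiten R H)
      = trace (H * ((matSqrt R)⁻¹ * (matLog (whiten R P) * (whiten R P)⁻¹) * (matSqrt R)⁻¹)) := by
        conv_lhs => rw [whiten.eq_1 R H, ← mul_assoc, trace_mul_comm]
        conv_rhs => rw [trace_mul_comm]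
        simp only [mul_assoc]
    _ = -trace (H * ((matSqrt P)⁻¹ * matLog (whiten P R) * (matSqrt P)⁻¹)) := by
        rw [matLog_whiten_swap hP hR, mul_neg, trace_neg]
    _ = -trace (P⁻¹ * H * P⁻¹ * (matSqrt P * matLog (whiten P R) * matSqrt P)) := by
        rw [← inv_matSqrt_mul_self hP]
        generalize matSqrt P = p at *
        generalize matLog (whiten P R) = b
        refine congrArg _ (Eq.symm ?_)
        calc trace (p⁻¹ * p⁻¹ * H * (p⁻¹ * p⁻¹) * (p * b * p))
            = trace (p⁻¹ * (p⁻¹ * H * p⁻¹ * (p⁻¹ * p) * b * p)) := by simp only [mul_assoc]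
          _ = trace (p⁻¹ * (H * p⁻¹ * b * (p * p⁻¹))) := by
            rw [trace_mul_comm, hp1, mul_one]; simp only [mul_assoc]
          _ = trace (H * (p⁻¹ * b * p⁻¹)) := by
            rw [hp2, mul_one, trace_mul_comm]; simp only [mul_assoc]

end Whitening

/-! ### Riemannian exponential and logarithm, and geodesic hyperplanes -/

section ExpLog

theorem logMap_isSymm (P Q : Sym n) : (logMap P Q).IsSymm :=
  mul_mul_isSymm (matSqrt_isSymm _) (matLog_isSymm _)

/-- `log_P(Q)` as an element of `Sym(n)`. -/
noncomputable def logMapSym (P Q : Sym n) : Sym n := ⟨logMap P Q, logMap_isSymm P Q⟩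

theorem logMap_eq_of_eq_expMap {P Q W : Sym n} (hP : P ∈ SPD n)
    (h : (Q : Matrix (Fin n) (Fin n) ℝ) = expMap P W) : logMap P Q = W := by
  rw [logMap, h, expMap, whiten_matSqrt_mul_mul hP, matLog_exp (whiten_isSymm _ W.2),
    matSqrt_mul_whiten_mul hP]

theorem expMap_logMapSym {P Q : Sym n} (hP : P ∈ SPD n) (hQ : Q ∈ SPD n) :
    expMap P (logMapSym P Q) = Q := by
  simp only [expMap, logMapSym, logMap]
  rw [whiten_matSqrt_mul_mul hP, exp_matLog (whiten_posDef hP hQ),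
    matSqrt_mul_whiten_mul hP]

theorem mem_geodHyperplane_iff {P Q V : Sym n} (hP : P ∈ SPD n) (hQ : Q ∈ SPD n) :
    Q ∈ geodHyperplane P V ↔ trace ((V : Matrix (Fin n) (Fin n) ℝ) * logMap P Q) = 0 := by
  constructor
  · rintro ⟨W, hW, hQW⟩
    rw [logMap_eq_of_eq_expMap hP hQW, hW]
  · exact fun h => ⟨logMapSym P Q, h, (expMap_logMapSym hP hQ).symm⟩

theorem self_mem_geodHyperplane {P : Sym n} (hP : P ∈ SPD n) (V : Sym n) :
    P ∈ geodHyperplane P V := by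
  refine ⟨0, by simp, ?_⟩
  simp [expMap, whiten, matSqrt_mul_self hP]

end ExpLog

/-! ### The dimension of `Sym(n)` and its trace form -/

section Dimension

/-- A symmetric matrix is a function on unordered pairs of indices. -/
def symEquivSym2 (n : ℕ) : Sym n ≃ₗ[ℝ] (Sym2 (Fin n) → ℝ) where
  toFun A s := Sym2.lift ⟨fun i j => (A : Matrix (Fin n) (Fin n) ℝ) i j,
    fun i j => IsSymm.apply A.2 j i⟩ s
  invFun f := ⟨Matrix.of fun i j => f s(i, j), by
    refine IsSymm.ext fun i j => ?_
    simp [Sym2.eq_swap]⟩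
  map_add' A B := by
    ext s
    induction s with | h i j => simp
  map_smul' c A := by
    ext s
    induction s with | h i j => simp
  left_inv A := by
    ext i j
    simp
  right_inv f := by
    ext s
    induction s with | h i j => simp

theorem finrank_sym (n : ℕ) : Module.finrank ℝ (Sym n) = n * (n + 1) / 2 := by
  rw [(symEquivSym2 n).finrank_eq, Module.finrank_fintype_fun_eq_card, Sym2.card,
    Fintype.card_fin, Nat.choose_two_right, Nat.add_sub_cancel, mul_comm]

theorem eq_zero_of_trace_mul_self_eq_zero {V : Sym n}
    (h : trace ((V : Matrix (Fin n) (Fin n) ℝ) * (V : Matrix (Fin n) (Fin n) ℝ)) = 0) :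
    V = 0 := by
  have hV : (V : Matrix (Fin n) (Fin n) ℝ)ᴴ = V := by
    rw [conjTranspose_eq_transpose_of_trivial]
    exact V.2
  refine Subtype.ext (trace_conjTranspose_mul_self_eq_zero_iff.1 ?_)
  rwa [hV]

end Dimension

end SPDGeometry

/-! ### Local inverses of analytic maps -/

section LocalInverse

variable {E : Type*} [NormedAddCommGroup E] [NormedSpace ℝ E] [FiniteDimensional ℝ E]

theorem hasFDerivAt_equiv_of_injective {f : E → E} {x : E} (hf : DifferentiableAt ℝ f x)
    (hinj : Function.Injective (fderiv ℝ f x)) :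
    ∃ e : E ≃L[ℝ] E, HasFDerivAt f (e : E →L[ℝ] E) x := by
  let e := LinearEquiv.ofInjectiveEndo (fderiv ℝ f x).toLinearMap hinj
  exact ⟨e.toContinuousLinearEquiv, hf.hasFDerivAt⟩

theorem range_mem_nhds_of_fderiv_injective {f : E → E} {x : E} (hf : ContDiffAt ℝ ω f x)
    (hinj : Function.Injective (fderiv ℝ f x)) : Set.range f ∈ nhds (f x) := by
  have : CompleteSpace E := FiniteDimensional.complete ℝ E
  obtain ⟨e, he⟩ := hasFDerivAt_equiv_of_injective (hf.differentiableAt (by simp)) hinj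
  rw [← (hf.hasStrictFDerivAt' he (by simp)).map_nhds_eq_of_equiv]
  exact Filter.range_mem_map

theorem contDiffAt_of_leftInverse {f g : E → E} {x : E} (hf : ContDiffAt ℝ ω f x)
    (hinj : Function.Injective (fderiv ℝ f x)) (hg : Function.LeftInverse g f) :
    ContDiffAt ℝ ω g (f x) := by
  have : CompleteSpace E := FiniteDimensional.complete ℝ E
  obtain ⟨e, he⟩ := hasFDerivAt_equiv_of_injective (hf.differentiableAt (by simp)) hinj
  refine (hf.to_localInverse he (by simp)).congr_of_eventuallyEq ?_
  filter_upwards [(hf.hasStrictFDerivAt' he (by simp)).eventually_right_inverse] with y hy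
  conv_lhs => rw [← hy]
  exact hg _

/-- An analytic immersion between finite-dimensional spaces has, near each point, a smooth left
inverse defined on an open set of the target. Analyticity at a point, unlike smoothness of infinite
order at a point, is an open condition; this is what makes the maps smooth on open sets. -/
theorem exists_contDiffOn_leftInverse {F : Type*} [NormedAddCommGroup F] [NormedSpace ℝ F]
    [FiniteDimensional ℝ F] {f : E → F} {x : E} (hf : ContDiffAt ℝ ω f x)
    (hinj : Function.Injective (fderiv ℝ f x)) {S : Set E} (hS : S ∈ nhds x) :
    ∃ U : Set E, IsOpen U ∧ x ∈ U ∧ U ⊆ S ∧ ContDiffOn ℝ ∞ f U ∧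
      ∃ (W : Set F) (G : F → E), IsOpen W ∧ f '' U ⊆ W ∧ ContDiffOn ℝ ∞ G W ∧
        ∀ y ∈ U, G (f y) = y := by
  have : CompleteSpace E := FiniteDimensional.complete ℝ E
  -- Composing with a linear left inverse `B` of the differential yields a local diffeomorphism.
  obtain ⟨B₀, hB₀⟩ := LinearMap.exists_leftInverse_of_injective (fderiv ℝ f x).toLinearMap
    (LinearMap.ker_eq_bot.2 hinj)
  let B : F →L[ℝ] E := LinearMap.toContinuousLinearMap B₀
  have hBf : ContDiffAt ℝ ω (B ∘ f) x := B.contDiff.contDiffAt.comp x hf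
  have hd : HasFDerivAt (B ∘ f) ((ContinuousLinearEquiv.refl ℝ E : E ≃L[ℝ] E) : E →L[ℝ] E) x := by
    refine (B.hasFDerivAt.comp x (hf.differentiableAt (by simp)).hasFDerivAt).congr_fderiv ?_
    ext v
    exact DFunLike.congr_fun hB₀ v
  set g : E → E := hBf.localInverse hd (by simp)
  have hgs : ∀ᶠ y in nhds ((B ∘ f) x), ContDiffAt ℝ ω g y :=
    (hBf.to_localInverse hd (by simp)).eventually (by simp)
  have hleft : ∀ᶠ y in nhds x, g ((B ∘ f) y) = y :=
    (hBf.hasStrictFDerivAt' hd (by simp)).eventually_left_inverse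
  obtain ⟨V, hV, hVo, hxV⟩ := eventually_nhds_iff.1 hgs
  obtain ⟨U, hU, hUo, hxU⟩ := eventually_nhds_iff.1
    ((hleft.and (hf.eventually (by simp))).and
      (Filter.Eventually.and hS (hBf.continuousAt.eventually (hVo.mem_nhds hxV))))
  refine ⟨U, hUo, hxU, fun y hy => (hU y hy).2.1,
    fun y hy => ((hU y hy).1.2.of_le le_top).contDiffWithinAt,
    B ⁻¹' V, g ∘ B, hVo.preimage B.continuous, ?_, ?_, fun y hy => (hU y hy).1.1⟩
  · rintro _ ⟨y, hy, rfl⟩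
    exact (hU y hy).2.2
  · intro y hy
    exact (((hV (B y) hy).comp y B.contDiff.contDiffAt).of_le le_top).contDiffWithinAt

end LocalInverse

namespace SPDGeometry

open Matrix

variable {n : ℕ}

/-! ### Analyticity and differential of the logarithm on `SPD(n)` -/

section Smoothness

attribute [local instance] Matrix.frobeniusNormedRing Matrix.frobeniusNormedAlgebra
  Matrix.frobeniusNormedAddCommGroup Matrix.frobeniusNormedSpace

/-- The trace as a continuous linear functional. -/
noncomputable def traceCLM (n : ℕ) : Matrix (Fin n) (Fin n) ℝ →L[ℝ] ℝ :=
  LinearMap.toContinuousLinearMap (Matrix.traceLinearMap (Fin n) ℝ ℝ)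

/-- The matrix exponential as a map of `Sym(n)` to itself. -/
noncomputable def expSym (X : Sym n) : Sym n :=
  ⟨NormedSpace.exp (X : Matrix (Fin n) (Fin n) ℝ), isSymm_of_posDef (posDef_exp X.2)⟩

/-- The matrix logarithm as a map of `Sym(n)` to itself. -/
noncomputable def logSym (A : Sym n) : Sym n := ⟨matLog A, matLog_isSymm _⟩

theorem expSym_mem_SPD (X : Sym n) : expSym X ∈ SPD n := posDef_exp X.2

theorem expSym_logSym {A : Sym n} (hA : A ∈ SPD n) : expSym (logSym A) = A :=
  Subtype.ext (exp_matLog hA)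

theorem logSym_expSym (X : Sym n) : logSym (expSym X) = X := Subtype.ext (matLog_exp X.2)

theorem contDiff_expSym : ContDiff ℝ ω (expSym : Sym n → Sym n) := by
  -- A linear projection `π` onto `Sym(n)` exhibits `exp` on `Sym(n)` as a composition.
  obtain ⟨π₀, hπ₀⟩ := LinearMap.exists_leftInverse_of_injective (Sym n).subtype (Sym n).ker_subtype
  let π : Matrix (Fin n) (Fin n) ℝ →L[ℝ] Sym n := LinearMap.toContinuousLinearMap π₀
  have hπ : ∀ X : Sym n, π X = X := DFunLike.congr_fun hπ₀
  have h : (expSym : Sym n → Sym n) =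
      fun X => π (NormedSpace.exp ((Sym n).subtypeL X)) := funext fun X => (hπ (expSym X)).symm
  rw [h]
  exact π.contDiff.comp (contDiff_normedSpace_exp.comp (Sym n).subtypeL.contDiff)

theorem hasFDerivAt_expSym (X : Sym n) : HasFDerivAt expSym (fderiv ℝ expSym X) X :=
  (contDiff_expSym.differentiable (by simp) X).hasFDerivAt

theorem coe_fderiv_expSym (X H : Sym n) :
    (fderiv ℝ expSym X H : Matrix (Fin n) (Fin n) ℝ) =
      fderiv ℝ NormedSpace.exp (X : Matrix (Fin n) (Fin n) ℝ) H := by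
  have h1 := (Sym n).subtypeL.hasFDerivAt.comp X (hasFDerivAt_expSym X)
  have h2 := (hasFDerivAt_normedSpace_exp (X : Matrix (Fin n) (Fin n) ℝ)).comp X
    (Sym n).subtypeL.hasFDerivAt
  exact DFunLike.congr_fun (h1.unique h2) H

/-- A direction killed by the derivative of `exp` at `X` commutes with `exp X`, hence with its
logarithm `X`; but in commuting directions the derivative is multiplication by `exp X`. -/
theorem fderiv_expSym_injective (X : Sym n) :
    Function.Injective (fderiv ℝ (expSym : Sym n → Sym n) X) := by
  refine (injective_iff_map_eq_zero _).2 fun H hH => ?_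
  have h0 : fderiv ℝ NormedSpace.exp (X : Matrix (Fin n) (Fin n) ℝ) H = 0 := by
    rw [← coe_fderiv_expSym, hH]
    rfl
  have hs : IsSelfAdjoint (NormedSpace.exp (X : Matrix (Fin n) (Fin n) ℝ)) := (posDef_exp X.2).1
  have h1 := mul_cfc_eq_cfc_mul Real.log hs hs (commute_exp_of_fderiv_exp_eq_zero h0).symm.eq
  change _ * matLog _ = matLog _ * _ at h1
  rw [matLog_exp X.2] at h1
  have h2 := (fderiv_exp_apply_of_commute
    (show Commute (X : Matrix (Fin n) (Fin n) ℝ) H from h1.symm)).symm.trans h0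
  exact Subtype.ext ((posDef_exp X.2).isUnit.mul_right_eq_zero.1 h2)

theorem SPD_mem_nhds {A : Sym n} (hA : A ∈ SPD n) : SPD n ∈ nhds A := by
  have h := range_mem_nhds_of_fderiv_injective contDiff_expSym.contDiffAt
    (fderiv_expSym_injective (logSym A))
  rw [expSym_logSym hA] at h
  exact Filter.mem_of_superset h (Set.range_subset_iff.2 expSym_mem_SPD)

theorem contDiffAt_logSym {A : Sym n} (hA : A ∈ SPD n) : ContDiffAt ℝ ω logSym A := by
  have h := contDiffAt_of_leftInverse contDiff_expSym.contDiffAt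
    (fderiv_expSym_injective (logSym A)) logSym_expSym
  rwa [expSym_logSym hA] at h

theorem hasFDerivAt_logSym {A : Sym n} (hA : A ∈ SPD n) :
    HasFDerivAt logSym (fderiv ℝ logSym A) A :=
  ((contDiffAt_logSym hA).differentiableAt (by simp)).hasFDerivAt

theorem fderiv_expSym_fderiv_logSym {A : Sym n} (hA : A ∈ SPD n) (H : Sym n) :
    fderiv ℝ expSym (logSym A) (fderiv ℝ logSym A H) = H := by
  have h1 := (hasFDerivAt_expSym (logSym A)).comp A (hasFDerivAt_logSym hA)
  have h2 : HasFDerivAt (expSym ∘ logSym) (ContinuousLinearMap.id ℝ (Sym n)) A := by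
    refine (hasFDerivAt_id A).congr_of_eventuallyEq ?_
    filter_upwards [SPD_mem_nhds hA] with B hB using expSym_logSym hB
  exact DFunLike.congr_fun (h1.unique h2) H

/-- Under the trace against `log A`, the derivative of `log` at `A` becomes multiplication by
`A⁻¹`, as for commuting matrices. -/
theorem trace_matLog_mul_fderiv_logSym {A : Sym n} (hA : A ∈ SPD n) (H : Sym n) :
    trace (matLog (A : Matrix (Fin n) (Fin n) ℝ) *
        (fderiv ℝ logSym A H : Matrix (Fin n) (Fin n) ℝ)) =
      trace (matLog (A : Matrix (Fin n) (Fin n) ℝ) * (A : Matrix (Fin n) (Fin n) ℝ)⁻¹ *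
        (H : Matrix (Fin n) (Fin n) ℝ)) := by
  have hexp := exp_matLog hA
  have hdet := (isUnit_iff_isUnit_det _).1 (Matrix.PosDef.isUnit hA)
  have hcomm : Commute (matLog (A : Matrix (Fin n) (Fin n) ℝ) * (A : Matrix (Fin n) (Fin n) ℝ)⁻¹)
      (matLog (A : Matrix (Fin n) (Fin n) ℝ)) := by
    refine (Commute.refl _).mul_left ?_
    have hneg : (A : Matrix (Fin n) (Fin n) ℝ)⁻¹ =
        NormedSpace.exp (-matLog (A : Matrix (Fin n) (Fin n) ℝ)) := by
      rw [Matrix.exp_neg, hexp]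
    rw [hneg]
    exact (Commute.refl _).neg_left.exp_left
  have key := trace_mul_fderiv_exp (traceCLM n) (fun a b => trace_mul_comm a b) hcomm
    (fderiv ℝ logSym A H : Sym n)
  have h := coe_fderiv_expSym (logSym A) (fderiv ℝ logSym A H)
  rw [fderiv_expSym_fderiv_logSym hA] at h
  change _ = fderiv ℝ NormedSpace.exp (matLog (A : Matrix (Fin n) (Fin n) ℝ)) _ at h
  have key' : trace (matLog (A : Matrix (Fin n) (Fin n) ℝ) *
        (A : Matrix (Fin n) (Fin n) ℝ)⁻¹ * (H : Matrix (Fin n) (Fin n) ℝ)) =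
      trace (matLog (A : Matrix (Fin n) (Fin n) ℝ) * (A : Matrix (Fin n) (Fin n) ℝ)⁻¹ *
        NormedSpace.exp (matLog (A : Matrix (Fin n) (Fin n) ℝ)) *
          (fderiv ℝ logSym A H : Matrix (Fin n) (Fin n) ℝ)) :=
    (congrArg (fun K => trace (matLog (A : Matrix (Fin n) (Fin n) ℝ) *
      (A : Matrix (Fin n) (Fin n) ℝ)⁻¹ * K)) h).trans key
  rw [hexp, mul_assoc _ (_)⁻¹ (A : Matrix (Fin n) (Fin n) ℝ), nonsing_inv_mul _ hdet,
    mul_one] at key'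
  exact key'.symm

end Smoothness

/-! ### The differential of the squared distance -/

section FrechetMap

attribute [local instance] Matrix.frobeniusNormedRing Matrix.frobeniusNormedAlgebra
  Matrix.frobeniusNormedAddCommGroup Matrix.frobeniusNormedSpace

theorem riemDist_sq (P Q : Sym n) : riemDist P Q ^ 2 =
    trace (matLog (whiten (P : Matrix (Fin n) (Fin n) ℝ) Q) *
      matLog (whiten (P : Matrix (Fin n) (Fin n) ℝ) Q)) := by
  rw [riemDist, sq (matLog _), Real.sq_sqrt]
  have h := (posSemidef_conjTranspose_mul_self
    (matLog (whiten (P : Matrix (Fin n) (Fin n) ℝ) Q))).trace_nonneg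
  rwa [conjTranspose_eq_transpose_of_trivial, (matLog_isSymm _).eq] at h

/-- The congruence `A ↦ R^{-1/2} A R^{-1/2}` as a continuous linear map of `Sym(n)`. -/
noncomputable def whitenCLM (R : Sym n) : Sym n →L[ℝ] Sym n :=
  LinearMap.toContinuousLinearMap
    { toFun := fun A => ⟨whiten (R : Matrix (Fin n) (Fin n) ℝ) A, whiten_isSymm _ A.2⟩
      map_add' := fun A B => Subtype.ext (by simp [whiten, mul_add, add_mul])
      map_smul' := fun c A => Subtype.ext (by simp [whiten]) }

theorem whitenCLM_mem_SPD {R A : Sym n} (hR : R ∈ SPD n) (hA : A ∈ SPD n) :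
    whitenCLM R A ∈ SPD n := whiten_posDef hR hA

theorem contDiffAt_riemDist_sq {R P : Sym n} (hR : R ∈ SPD n) (hP : P ∈ SPD n) :
    ContDiffAt ℝ ω (fun P => riemDist R P ^ 2) P := by
  simp only [riemDist_sq]
  have h : ContDiffAt ℝ ω (fun Q : Sym n => (Sym n).subtypeL (logSym (whitenCLM R Q))) P :=
    (Sym n).subtypeL.contDiff.contDiffAt.comp P
      ((contDiffAt_logSym (whitenCLM_mem_SPD hR hP)).comp P (whitenCLM R).contDiff.contDiffAt)
  exact (traceCLM n).contDiff.contDiffAt.comp P (h.mul h)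

/-- In terms of the affine-invariant metric `⟨V, W⟩_P = Tr(P⁻¹ V P⁻¹ W)`: the gradient of `d(R, ·)²`
at `P` is `-2 log_P(R)`. -/
theorem fderiv_riemDist_sq {R P : Sym n} (hR : R ∈ SPD n) (hP : P ∈ SPD n) (H : Sym n) :
    fderiv ℝ (fun P => riemDist R P ^ 2) P H =
      -2 * trace ((P : Matrix (Fin n) (Fin n) ℝ)⁻¹ * (H : Matrix (Fin n) (Fin n) ℝ) *
        (P : Matrix (Fin n) (Fin n) ℝ)⁻¹ * logMap P R) := by
  simp only [riemDist_sq]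
  have hA := whitenCLM_mem_SPD hR hP
  have h : HasFDerivAt (fun Q : Sym n => (Sym n).subtypeL (logSym (whitenCLM R Q)))
      ((Sym n).subtypeL.comp ((fderiv ℝ logSym (whitenCLM R P)).comp (whitenCLM R))) P :=
    (Sym n).subtypeL.hasFDerivAt.comp P
      ((hasFDerivAt_logSym hA).comp P (whitenCLM R).hasFDerivAt)
  have hd := (traceCLM n).hasFDerivAt.comp P (h.mul' h)
  refine (DFunLike.congr_fun hd.fderiv H).trans ?_
  let D : Matrix (Fin n) (Fin n) ℝ :=
    (Sym n).subtype (fderiv ℝ logSym (whitenCLM R P) (whitenCLM R H))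
  have hlog : trace (matLog (whiten (R : Matrix (Fin n) (Fin n) ℝ) P) * D) =
      -trace ((P : Matrix (Fin n) (Fin n) ℝ)⁻¹ * (H : Matrix (Fin n) (Fin n) ℝ) *
        (P : Matrix (Fin n) (Fin n) ℝ)⁻¹ * logMap P R) :=
    (trace_matLog_mul_fderiv_logSym hA (whitenCLM R H)).trans (trace_matLog_whiten hP hR H)
  have hgoal : trace (matLog (whiten (R : Matrix (Fin n) (Fin n) ℝ) P) * D +
      D * matLog (whiten (R : Matrix (Fin n) (Fin n) ℝ) P)) =
      -2 * trace ((P : Matrix (Fin n) (Fin n) ℝ)⁻¹ * (H : Matrix (Fin n) (Fin n) ℝ) *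
        (P : Matrix (Fin n) (Fin n) ℝ)⁻¹ * logMap P R) := by
    rw [trace_add, trace_mul_comm D, hlog]
    ring
  exact hgoal

end FrechetMap

end SPDGeometry

namespace SPDGeometry

open Matrix

variable {n ℓ : ℕ}

/-! ### The set `Γ` and geodesic hyperplanes -/

section Gamma

/-- The trace pairing `V ↦ Tr(V ·)` of `Sym(n)` with itself. -/
def tracePairing (n : ℕ) : Sym n →ₗ[ℝ] Module.Dual ℝ (Sym n) :=
  LinearMap.mk₂ ℝ (fun V W : Sym n =>
      trace ((V : Matrix (Fin n) (Fin n) ℝ) * (W : Matrix (Fin n) (Fin n) ℝ)))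
    (fun _ _ _ => by simp [add_mul]) (fun _ _ _ => by simp)
    (fun _ _ _ => by simp [mul_add]) (fun _ _ _ => by simp)

theorem tracePairing_injective (n : ℕ) : Function.Injective (tracePairing n) :=
  (injective_iff_map_eq_zero _).2 fun V hV =>
    eq_zero_of_trace_mul_self_eq_zero (DFunLike.congr_fun hV V)

theorem tracePairing_surjective (n : ℕ) : Function.Surjective (tracePairing n) :=
  (LinearMap.injective_iff_surjective_of_finrank_eq_finrank
    Subspace.dual_finrank_eq.symm).1 (tracePairing_injective n)

/-- A family spans `Sym(n)` exactly if only the zero matrix is orthogonal to it. -/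
theorem span_eq_top_iff_trace {ι : Type*} (L : ι → Sym n) :
    Submodule.span ℝ (Set.range L) = ⊤ ↔ ∀ V : Sym n,
      (∀ i, trace ((V : Matrix (Fin n) (Fin n) ℝ) * (L i : Matrix (Fin n) (Fin n) ℝ)) = 0) →
        V = 0 := by
  constructor
  · intro h V hV
    have hle : Submodule.span ℝ (Set.range L) ≤ LinearMap.ker (tracePairing n V) := by
      rw [Submodule.span_le]
      rintro _ ⟨i, rfl⟩
      exact hV i
    rw [h] at hle
    exact eq_zero_of_trace_mul_self_eq_zero (hle (Submodule.mem_top : V ∈ ⊤))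
  · intro h
    by_contra hne
    obtain ⟨f, hf, hle⟩ := Submodule.exists_le_ker_of_lt_top _ (lt_top_iff_ne_top.2 hne)
    obtain ⟨V, rfl⟩ := tracePairing_surjective n f
    refine hf ?_
    rw [h V fun i => hle (Submodule.subset_span ⟨i, rfl⟩), map_zero]

theorem mem_Gam_iff (R : Fin ℓ → SPD n) {P : Sym n} (hP : P ∈ SPD n) :
    P ∈ Gam R ↔ ∀ V : Sym n,
      (∀ i, trace ((V : Matrix (Fin n) (Fin n) ℝ) * logMap P (R i)) = 0) → V = 0 := by
  have hspan : Submodule.span ℝ (Set.range fun i => logMap P (R i)) =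
      (Submodule.span ℝ (Set.range fun i => logMapSym P (R i))).map (Sym n).subtype := by
    rw [Submodule.map_span, ← Set.range_comp]
    rfl
  refine Iff.trans ?_ (span_eq_top_iff_trace fun i => logMapSym P (R i))
  rw [Gam, Set.mem_ofPred_eq, hspan, Submodule.finrank_map_subtype_eq, ← finrank_sym]
  exact ⟨fun h => Submodule.eq_top_of_finrank_eq h.2, fun h => ⟨hP, by rw [h, finrank_top]⟩⟩

theorem Gam_eq (R : Fin ℓ → SPD n) :
    Gam R = SPD n \ {P | ∃ V : Sym n, V ≠ 0 ∧ ∀ i, (R i : Sym n) ∈ geodHyperplane P V} := by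
  ext P
  by_cases hP : P ∈ SPD n
  · rw [mem_Gam_iff R hP]
    simp only [Set.mem_sdiff, hP, true_and, Set.mem_ofPred_eq, mem_geodHyperplane_iff hP (R _).2]
    push Not
    exact forall_congr' fun V => by rw [← not_imp_not]; push Not; rfl
  · exact iff_of_false (fun h => hP h.1) fun h => hP h.1

theorem diff_sUnion_hyperplanesThrough_subset_Gam (R : Fin ℓ → SPD n) :
    SPD n \ ⋃₀ hyperplanesThrough R ⊆ Gam R := by
  rintro P ⟨hP, hPH⟩
  rw [Gam_eq]
  refine ⟨hP, ?_⟩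
  rintro ⟨V, hV, hR⟩
  -- The base point of a geodesic hyperplane lies on it.
  exact hPH ⟨_, ⟨⟨P, hP, V, hV, rfl⟩, hR⟩, self_mem_geodHyperplane hP V⟩

end Gamma

/-! ### Local invertibility of the squared Fréchet map -/

section Invertibility

attribute [local instance] Matrix.frobeniusNormedAddCommGroup Matrix.frobeniusNormedSpace

theorem contDiffAt_frechetMap (R : Fin ℓ → SPD n) {P : Sym n} (hP : P ∈ SPD n) :
    ContDiffAt ℝ ω (frechetMap R) P :=
  contDiffAt_pi.2 fun i => contDiffAt_riemDist_sq (R i).2 hP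

theorem fderiv_frechetMap (R : Fin ℓ → SPD n) {P : Sym n} (hP : P ∈ SPD n) (H : Sym n)
    (i : Fin ℓ) : fderiv ℝ (frechetMap R) P H i =
      -2 * trace ((P : Matrix (Fin n) (Fin n) ℝ)⁻¹ * (H : Matrix (Fin n) (Fin n) ℝ) *
        (P : Matrix (Fin n) (Fin n) ℝ)⁻¹ * logMap P (R i)) := by
  have h := (contDiffAt_frechetMap R hP).differentiableAt (by simp)
  have hi := hasFDerivAt_pi'.1 h.hasFDerivAt i
  exact (DFunLike.congr_fun hi.fderiv H).symm.trans (fderiv_riemDist_sq (R i).2 hP H)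

theorem fderiv_frechetMap_injective (R : Fin ℓ → SPD n) {P : Sym n} (hP : P ∈ Gam R) :
    Function.Injective (fderiv ℝ (frechetMap R) P) := by
  refine (injective_iff_map_eq_zero _).2 fun H hH => ?_
  have hpos : (P : Matrix (Fin n) (Fin n) ℝ).PosDef := hP.1
  have hu : IsUnit (P : Matrix (Fin n) (Fin n) ℝ)⁻¹ := isUnit_nonsing_inv_iff.2 hpos.isUnit
  let V : Sym n := ⟨(P : Matrix (Fin n) (Fin n) ℝ)⁻¹ * H * (P : Matrix (Fin n) (Fin n) ℝ)⁻¹,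
    mul_mul_isSymm (inv_isSymm P.2) H.2⟩
  have hV : V = 0 := (mem_Gam_iff R hP.1).1 hP V fun i => by
    have h := fderiv_frechetMap R hP.1 H i
    rw [hH] at h
    have h' : 0 = -2 * trace ((V : Matrix (Fin n) (Fin n) ℝ) * logMap P (R i)) := h
    linarith
  have h0 : (P : Matrix (Fin n) (Fin n) ℝ)⁻¹ * (H : Matrix (Fin n) (Fin n) ℝ) *
      (P : Matrix (Fin n) (Fin n) ℝ)⁻¹ = 0 := congrArg Subtype.val hV
  exact Subtype.ext (hu.mul_right_eq_zero.1 (hu.mul_left_eq_zero.1 h0))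

theorem isLocallyInvertibleAt_frechetMap (R : Fin ℓ → SPD n) {P : Sym n} (hP : P ∈ Gam R) :
    IsLocallyInvertibleAt (frechetMap R) P := by
  have hinj := fderiv_frechetMap_injective R hP
  have hc := contDiffAt_frechetMap R hP.1
  refine ⟨⟨hc.differentiableAt (by simp), ?_⟩,
    exists_contDiffOn_leftInverse hc hinj (SPD_mem_nhds hP.1)⟩
  rw [← finrank_sym]
  exact LinearMap.finrank_range_of_inj hinj

end Invertibility

end SPDGeometry

theorem mainTheorem8 (n ℓ : ℕ) (R : Fin ℓ → SPDGeometry.SPD n) :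
    (∀ P ∈ SPDGeometry.Gam R,
      SPDGeometry.IsLocallyInvertibleAt (SPDGeometry.frechetMap R) P) ∧
    SPDGeometry.Gam R =
      SPDGeometry.SPD n \ {P | ∃ V : SPDGeometry.Sym n, V ≠ 0 ∧
        ∀ i, (R i : SPDGeometry.Sym n) ∈ SPDGeometry.geodHyperplane P V} ∧
    SPDGeometry.SPD n \ ⋃₀ SPDGeometry.hyperplanesThrough R ⊆ SPDGeometry.Gam R ∧
    (∀ P ∈ SPDGeometry.SPD n \ ⋃₀ SPDGeometry.hyperplanesThrough R,
      SPDGeometry.IsLocallyInvertibleAt (SPDGeometry.frechetMap R) P) :=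
  ⟨fun _ hP => SPDGeometry.isLocallyInvertibleAt_frechetMap R hP, SPDGeometry.Gam_eq R,
    SPDGeometry.diff_sUnion_hyperplanesThrough_subset_Gam R, fun _ hP =>
      SPDGeometry.isLocallyInvertibleAt_frechetMap R
        (SPDGeometry.diff_sUnion_hyperplanesThrough_subset_Gam R hP)⟩
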